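/- Let $E$ be a real Banach space and let $M$ be a smooth ($C^\infty$) manifold without boundary modelled on $E$. For $x\in M$, call two smooth curves $\gamma_1,\gamma_2:(-\epsilon,\epsilon)\to M$ with $\gamma_i(0)=x$ $k$-equivalent if their derivatives at $0$ of orders $1,\dots,k$ agree in charts; let $T^k_xM$ be the set of classes $[\gamma,x]_k$, let $T^kM=\bigcup_{x\in M}T^k_xM$ and let $\pi_k:T^kM\to M$, $[\gamma,x]_k\mapsto x$. $T^kM$ carries the smooth manifold structure with charts $$[\gamma,x]_k\mapsto\Big((\psi\circ\gamma)(0),(\psi\circ\gamma)'(0),\dots,\tfrac1{k!}(\psi\circ\gamma)^{(k)}(0)\Big)\in\psi(U)\times E^k,$$ where $(U,\psi)$ runs through the charts of an atlas of $M$. **Theorem 3.6.** Let $k\ge 2$ and let $M$ be $C^k$-partitionable, i.e. Hausdorff and paracompact and such that every open cover of $M$ has a subordinate partition of unity of class $C^k$. Suppose that $\pi_k:T^kM\to M$ admits a smooth vector bundle structure, compatible with the above manifold structure of $T^kM$, which is isomorphic, as a smooth vector bundle over $M$, to the Whitney sum $\bigoplus_{i=1}^kTM$. Then $M$ admits a smooth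 linear connection, i.e. a smooth vector bundle morphism $K:T(TM)\to TM$ over $TM\to M$ which in each chart $(U,\psi)$ has the form $$K_\psi(x,\xi;y,\eta)=(x,\ \eta+\Gamma_\psi(x)(\xi)\,y)$$ with a smooth local component $\Gamma_\psi:\psi(U)\to L(E,L(E,E))$. -/

import Mathlib

open Set Filter Topology Bundle
open scoped Manifold ContDiff

noncomputable section

section Curves

variable (E : Type*) [NormedAddCommGroup E] [NormedSpace ℝ E]
  {M : Type*} [TopologicalSpace M] [ChartedSpace E M]

/-- Smooth curves `γ : (-ε, ε) → M` with `γ 0 = x`. The curve is stored as a function on `ℝ`, whose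
values outside `(-ε, ε)` are irrelevant. -/
structure SmoothCurveAt (x : M) where
  toFun : ℝ → M
  map_zero : toFun 0 = x
  smooth : ∃ ε > (0 : ℝ), ContMDiffOn 𝓘(ℝ, ℝ) 𝓘(ℝ, E) ∞ toFun (Ioo (-ε) ε)

/-- Two smooth curves at `x` are `k`-equivalent if their derivatives at `0` of orders `1, …, k`
agree (in every chart around `x`). -/
def jetSetoid (k : ℕ) (x : M) : Setoid (SmoothCurveAt E x) where
  r γ₁ γ₂ := ∀ e ∈ atlas E M, x ∈ e.source → ∀ j, 1 ≤ j → j ≤ k →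
    iteratedDeriv j (e ∘ γ₁.toFun) 0 = iteratedDeriv j (e ∘ γ₂.toFun) 0
  iseqv :=
    { refl := fun _ _ _ _ _ _ _ => rfl
      symm := fun h e he hx j h1 hk => (h e he hx j h1 hk).symm
      trans := fun h h' e he hx j h1 hk => (h e he hx j h1 hk).trans (h' e he hx j h1 hk) }

/-- The fibre `T_x^k M`: classes `[γ, x]_k` of smooth curves at `x`. -/
def OscFiber (k : ℕ) (x : M) : Type _ := Quotient (jetSetoid E k x)

/-- The class `[γ, x]_k`. -/
def OscFiber.mk (k : ℕ) {x : M} (γ : SmoothCurveAt E x) : OscFiber E k x :=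
  Quotient.mk (jetSetoid E k x) γ

variable (M) in
/-- The tangent bundle of order `k`, `T^k M = ⋃ x, T_x^k M`. -/
structure OscBundle (k : ℕ) where
  /-- The projection `π_k : T^k M → M`. -/
  proj : M
  jet : OscFiber E k proj

variable {E} in
/-- The coordinates `(γ_e'(0), (1/2!) γ_e''(0), …, (1/k!) γ_e^(k)(0))` of a curve in a chart `e`,
where `γ_e = e ∘ γ`. -/
def curveCoord (k : ℕ) (e : OpenPartialHomeomorph M E) (γ : ℝ → M) : Fin k → E :=
  fun i => ((Nat.factorial (i + 1) : ℝ)⁻¹) • iteratedDeriv (i + 1) (e ∘ γ) 0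

variable {E} in
/-- The polynomial curve `t ↦ y + t ξ₁ + ⋯ + t^k ξ_k` in the model space. -/
def polyCurve {k : ℕ} (y : E) (ξ : Fin k → E) (t : ℝ) : E :=
  y + ∑ i : Fin k, t ^ ((i : ℕ) + 1) • ξ i

theorem polyCurve_zero {k : ℕ} (y : E) (ξ : Fin k → E) : polyCurve y ξ 0 = y := by
  simp [polyCurve]

theorem contDiff_polyCurve {k : ℕ} (y : E) (ξ : Fin k → E) : ContDiff ℝ ∞ (polyCurve y ξ) := by
  unfold polyCurve
  fun_prop

theorem iteratedDeriv_polyCurve {k : ℕ} (y : E) (ξ : Fin k → E) (i : Fin k) :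
    iteratedDeriv (i + 1) (polyCurve y ξ) 0 = (Nat.factorial (i + 1) : ℝ) • ξ i := by
  have h : polyCurve y ξ = fun t : ℝ => y + ∑ i : Fin k, t ^ ((i : ℕ) + 1) • ξ i := rfl
  rw [h, iteratedDeriv_const_add (by omega)]
  rw [iteratedDeriv_fun_sum (fun j _ => by fun_prop)]
  have key : ∀ j : Fin k, iteratedDeriv ((i : ℕ) + 1) (fun t : ℝ => t ^ ((j : ℕ) + 1) • ξ j) 0
      = if i = j then (Nat.factorial (i + 1) : ℝ) • ξ j else 0 := by
    intro j
    have := iteratedDeriv_smul_const (n := (i : ℕ) + 1) (x := (0 : ℝ))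
      (f := fun t : ℝ => t ^ ((j : ℕ) + 1)) (by fun_prop) (ξ j)
    erw [this, iteratedDeriv_fun_pow_zero]
    by_cases hij : i = j
    · subst hij; simp
    · have : (i : ℕ) ≠ j := fun h => hij (Fin.ext h)
      simp [hij, this]
  simp [key]

variable {E}

theorem SmoothCurveAt.contDiffAt [IsManifold 𝓘(ℝ, E) ∞ M] {x : M} (γ : SmoothCurveAt E x)
    {e : OpenPartialHomeomorph M E} (he : e ∈ atlas E M) (hx : x ∈ e.source) :
    ContDiffAt ℝ ∞ (e ∘ γ.toFun) 0 := by
  obtain ⟨ε, hε, hγ⟩ := γ.smooth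
  have h1 : ContMDiffAt 𝓘(ℝ, ℝ) 𝓘(ℝ, E) ∞ γ.toFun 0 :=
    hγ.contMDiffAt (Ioo_mem_nhds (by linarith) hε)
  have h2 : ContMDiffAt 𝓘(ℝ, E) 𝓘(ℝ, E) ∞ e (γ.toFun 0) :=
    (contMDiffOn_of_mem_maximalAtlas (IsManifold.subset_maximalAtlas he)).contMDiffAt
      (e.open_source.mem_nhds (by rw [γ.map_zero]; exact hx))
  exact (h2.comp (0 : ℝ) h1).contDiffAt

theorem contDiffOn_transition [IsManifold 𝓘(ℝ, E) ∞ M] {e e' : OpenPartialHomeomorph M E}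
    (he : e ∈ atlas E M) (he' : e' ∈ atlas E M) :
    ContDiffOn ℝ ∞ (e' ∘ e.symm) (e.symm.trans e').source := by
  rw [← contMDiffOn_iff_contDiffOn]
  have h1 : ContMDiffOn 𝓘(ℝ, E) 𝓘(ℝ, E) ∞ e.symm e.target :=
    contMDiffOn_symm_of_mem_maximalAtlas (IsManifold.subset_maximalAtlas he)
  have h2 : ContMDiffOn 𝓘(ℝ, E) 𝓘(ℝ, E) ∞ e' e'.source :=
    contMDiffOn_of_mem_maximalAtlas (IsManifold.subset_maximalAtlas he')
  refine h2.comp (h1.mono ?_) ?_ <;> intro y hy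
  · simp at hy; exact hy.1
  · simp at hy; exact hy.2

theorem contDiffAt_transition [IsManifold 𝓘(ℝ, E) ∞ M] {e e' : OpenPartialHomeomorph M E}
    (he : e ∈ atlas E M) (he' : e' ∈ atlas E M) {y : E} (hy : y ∈ (e.symm.trans e').source) :
    ContDiffAt ℝ ∞ (e' ∘ e.symm) y :=
  (contDiffOn_transition he he').contDiffAt ((e.symm.trans e').open_source.mem_nhds hy)

theorem contDiffAt_multilinear_apply {X F : Type*} [NormedAddCommGroup X] [NormedSpace ℝ X]
    [NormedAddCommGroup F] [NormedSpace ℝ F] {n : ℕ} {A : X → (E [×n]→L[ℝ] F)} {v : X → Fin n → E}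
    {x : X} (hA : ContDiffAt ℝ ∞ A x) (hv : ContDiffAt ℝ ∞ v x) :
    ContDiffAt ℝ ∞ (fun q => A q (v q)) x := by
  let T : (E [×n]→L[ℝ] F) →L[ℝ] (E [×n]→L[ℝ] F) := ContinuousLinearMap.id ℝ _
  exact (T.flipMultilinear.contDiff.contDiffAt.comp x hv).clm_apply hA

/-- The derivatives of a composition at `0` up to order `k` depend only on those of the curve. -/
theorem iteratedDeriv_comp_congr {g : E → E} {f₁ f₂ : ℝ → E} (h0 : f₁ 0 = f₂ 0)
    (hg : ContDiffAt ℝ ∞ g (f₁ 0)) (h₁ : ContDiffAt ℝ ∞ f₁ 0) (h₂ : ContDiffAt ℝ ∞ f₂ 0) {k : ℕ}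
    (h : ∀ j, 1 ≤ j → j ≤ k → iteratedDeriv j f₁ 0 = iteratedDeriv j f₂ 0) {j : ℕ}
    (hj : j ≤ k) : iteratedDeriv j (g ∘ f₁) 0 = iteratedDeriv j (g ∘ f₂) 0 := by
  rw [iteratedDeriv_vcomp_eq_sum_orderedFinpartition hg h₁ (by exact_mod_cast le_top),
    iteratedDeriv_vcomp_eq_sum_orderedFinpartition (h0 ▸ hg) h₂ (by exact_mod_cast le_top), h0]
  refine Finset.sum_congr rfl fun c _ => ?_
  congr 1
  funext m
  exact h _ (c.partSize_pos m) ((c.partSize_le m).trans hj)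

/-- Two curves are `k`-equivalent as soon as they have the same coordinates in one chart. -/
theorem jetSetoid_of_chart [IsManifold 𝓘(ℝ, E) ∞ M] {k : ℕ} {x : M} {γ₁ γ₂ : SmoothCurveAt E x}
    {e : OpenPartialHomeomorph M E} (he : e ∈ atlas E M) (hx : x ∈ e.source)
    (h : curveCoord k e γ₁.toFun = curveCoord k e γ₂.toFun) : jetSetoid E k x γ₁ γ₂ := by
  have hd : ∀ j, 1 ≤ j → j ≤ k →
      iteratedDeriv j (e ∘ γ₁.toFun) 0 = iteratedDeriv j (e ∘ γ₂.toFun) 0 := by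
    intro j h1 hk
    have := congrFun h ⟨j - 1, by omega⟩
    simp only [curveCoord] at this
    rw [Nat.sub_add_cancel h1] at this
    exact smul_right_injective E (inv_ne_zero (by exact_mod_cast Nat.factorial_ne_zero j)) this
  intro e' he' hx' j _ hk
  have hcongr : ∀ γ : SmoothCurveAt E x,
      iteratedDeriv j (e' ∘ γ.toFun) 0 = iteratedDeriv j ((e' ∘ e.symm) ∘ (e ∘ γ.toFun)) 0 := by
    intro γ
    apply Filter.EventuallyEq.iteratedDeriv_eq
    obtain ⟨ε, hε, hγ⟩ := γ.smooth
    have hc : ContinuousAt γ.toFun 0 :=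
      (hγ.contMDiffAt (Ioo_mem_nhds (by linarith) hε)).continuousAt
    have := hc.preimage_mem_nhds (e.open_source.mem_nhds (by rw [γ.map_zero]; exact hx))
    filter_upwards [this] with t ht
    simp [e.left_inv ht]
  rw [hcongr, hcongr]
  refine iteratedDeriv_comp_congr (by simp [γ₁.map_zero, γ₂.map_zero]) ?_ (γ₁.contDiffAt he hx)
    (γ₂.contDiffAt he hx) hd hk
  refine contDiffAt_transition he he' ?_
  simp [γ₁.map_zero, hx, hx']

/-- The coordinates of a class in a chart `e` around its base point: those of any representative
(`OscFiber.coord_mk`). -/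
def OscFiber.coord {k : ℕ} {x : M} (e : OpenPartialHomeomorph M E) (p : OscFiber E k x) :
    Fin k → E :=
  curveCoord k e (Quotient.out p : SmoothCurveAt E x).toFun

theorem OscFiber.coord_mk (k : ℕ) {x : M} {e : OpenPartialHomeomorph M E} (he : e ∈ atlas E M)
    (hx : x ∈ e.source) (γ : SmoothCurveAt E x) :
    (OscFiber.mk E k γ).coord e = curveCoord k e γ.toFun := by
  have h : jetSetoid E k x (Quotient.out (OscFiber.mk E k γ)) γ := Quotient.mk_out γ
  funext i
  simp only [OscFiber.coord, curveCoord]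
  rw [h e he hx (i + 1) (by omega) (by omega)]

/-- The curve `t ↦ e⁻¹ (y + t ξ₁ + ⋯ + t^k ξ_k)`. -/
def chartCurve [IsManifold 𝓘(ℝ, E) ∞ M] {k : ℕ} {e : OpenPartialHomeomorph M E}
    (he : e ∈ atlas E M) {y : E} (hy : y ∈ e.target) (ξ : Fin k → E) :
    SmoothCurveAt E (e.symm y) where
  toFun t := e.symm (polyCurve y ξ t)
  map_zero := by rw [polyCurve_zero]
  smooth := by
    have hmem : polyCurve y ξ ⁻¹' e.target ∈ 𝓝 (0 : ℝ) :=
      (contDiff_polyCurve E y ξ).continuous.continuousAt.preimage_mem_nhds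
        (e.open_target.mem_nhds (by rw [polyCurve_zero]; exact hy))
    obtain ⟨ε, hε, hb⟩ := Metric.mem_nhds_iff.1 hmem
    refine ⟨ε, hε, ?_⟩
    have h1 : ContMDiffOn 𝓘(ℝ, E) 𝓘(ℝ, E) ∞ e.symm e.target :=
      contMDiffOn_symm_of_mem_maximalAtlas (IsManifold.subset_maximalAtlas he)
    refine h1.comp (contDiff_polyCurve E y ξ).contMDiff.contMDiffOn ?_
    intro t ht
    apply hb
    rw [Real.ball_eq_Ioo]
    simpa using ht

theorem curveCoord_chartCurve [IsManifold 𝓘(ℝ, E) ∞ M] {k : ℕ} {e : OpenPartialHomeomorph M E}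
    (he : e ∈ atlas E M) {y : E} (hy : y ∈ e.target) (ξ : Fin k → E) :
    curveCoord k e (chartCurve he hy ξ).toFun = ξ := by
  have hmem : polyCurve y ξ ⁻¹' e.target ∈ 𝓝 (0 : ℝ) :=
    (contDiff_polyCurve E y ξ).continuous.continuousAt.preimage_mem_nhds
      (e.open_target.mem_nhds (by rw [polyCurve_zero]; exact hy))
  have : (e ∘ (chartCurve he hy ξ).toFun) =ᶠ[𝓝 0] polyCurve y ξ := by
    filter_upwards [hmem] with t ht
    exact e.right_inv ht
  funext i
  simp only [curveCoord]
  rw [this.iteratedDeriv_eq, iteratedDeriv_polyCurve, smul_smul, inv_mul_cancel₀, one_smul]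
  exact_mod_cast Nat.factorial_ne_zero _

theorem OscBundle.ext' {k : ℕ} {x x' : M} (h : x = x') {γ : SmoothCurveAt E x}
    {γ' : SmoothCurveAt E x'}
    (hγ : jetSetoid E k x' ⟨γ.toFun, γ.map_zero.trans h, γ.smooth⟩ γ') :
    (⟨x, OscFiber.mk E k γ⟩ : OscBundle E M k) = ⟨x', OscFiber.mk E k γ'⟩ := by
  subst h
  exact congrArg (OscBundle.mk x) (Quotient.sound hγ)

open Classical in
/-- The chart `Ψ_e^k : π_k⁻¹(U) → e(U) × E^k` of `T^k M` induced by a chart `e : U → E` of `M`,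
`[γ, x]_k ↦ ((e ∘ γ)(0), (e ∘ γ)'(0), …, (1/k!) (e ∘ γ)^(k)(0))`. -/
def oscChart [IsManifold 𝓘(ℝ, E) ∞ M] (k : ℕ) (e : OpenPartialHomeomorph M E)
    (he : e ∈ atlas E M) : PartialEquiv (OscBundle E M k) (E × (Fin k → E)) where
  toFun p := (e p.proj, p.jet.coord e)
  invFun q := ⟨e.symm q.1, OscFiber.mk E k
    (if h : q.1 ∈ e.target then chartCurve he h q.2
      else ⟨fun _ => e.symm q.1, rfl, 1, one_pos, contMDiffOn_const⟩)⟩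
  source := {p | p.proj ∈ e.source}
  target := e.target ×ˢ univ
  map_source' p hp := ⟨e.map_source hp, mem_univ _⟩
  map_target' q hq := e.map_target hq.1
  left_inv' := by
    rintro ⟨x, p⟩ hx
    change x ∈ e.source at hx
    obtain ⟨γ, rfl⟩ : ∃ γ, p = OscFiber.mk E k γ := ⟨Quotient.out p, (Quotient.out_eq p).symm⟩
    have ht := e.map_source hx
    simp only [ht, dite_true]
    refine OscBundle.ext' (e.left_inv hx) ?_
    refine jetSetoid_of_chart he hx ?_
    change curveCoord k e (chartCurve he ht _).toFun = _
    rw [curveCoord_chartCurve, OscFiber.coord_mk k he hx]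
  right_inv' := by
    rintro ⟨y, ξ⟩ ⟨hy, -⟩
    change y ∈ e.target at hy
    simp only [hy, dite_true]
    rw [OscFiber.coord_mk k he (e.map_target hy), curveCoord_chartCurve, e.right_inv hy]

theorem oscChart_trans_source [IsManifold 𝓘(ℝ, E) ∞ M] (k : ℕ) {e e' : OpenPartialHomeomorph M E}
    (he : e ∈ atlas E M) (he' : e' ∈ atlas E M) :
    ((oscChart k e he).symm.trans (oscChart k e' he')).source
      = (e.symm.trans e').source ×ˢ univ := by
  ext ⟨y, ξ⟩
  rw [PartialEquiv.trans_source]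
  change ((y ∈ e.target ∧ _) ∧ e.symm y ∈ e'.source) ↔ _
  simp

open Classical in
theorem oscChart_transition [IsManifold 𝓘(ℝ, E) ∞ M] (k : ℕ) {e e' : OpenPartialHomeomorph M E}
    (he : e ∈ atlas E M) (he' : e' ∈ atlas E M) {q : E × (Fin k → E)}
    (hq : q.1 ∈ (e.symm.trans e').source) :
    (oscChart k e he).symm.trans (oscChart k e' he') q
      = ((e' ∘ e.symm) q.1, fun i : Fin k => ((Nat.factorial (i + 1) : ℝ)⁻¹) •
          iteratedDeriv (i + 1) ((e' ∘ e.symm) ∘ polyCurve q.1 q.2) 0) := by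
  obtain ⟨y, ξ⟩ := q
  have hy : y ∈ e.target := by simp at hq; exact hq.1
  have hy' : e.symm y ∈ e'.source := by simp at hq; exact hq.2
  refine Prod.ext rfl ?_
  change (OscFiber.mk E k (if h : y ∈ e.target then chartCurve he h ξ
      else ⟨fun _ => e.symm y, rfl, 1, one_pos, contMDiffOn_const⟩)).coord e' = _
  rw [dif_pos hy]
  exact OscFiber.coord_mk k he' hy' _

theorem contDiffOn_oscChart_transition [IsManifold 𝓘(ℝ, E) ∞ M] (k : ℕ)
    {e e' : OpenPartialHomeomorph M E} (he : e ∈ atlas E M) (he' : e' ∈ atlas E M) :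
    ContDiffOn ℝ ∞ ((oscChart k e he).symm.trans (oscChart k e' he'))
      ((oscChart k e he).symm.trans (oscChart k e' he')).source := by
  rw [oscChart_trans_source]
  refine ContDiffOn.congr ?_ (fun q hq => oscChart_transition k he he' hq.1)
  rintro ⟨y, ξ⟩ ⟨hy, -⟩
  have hg := contDiffAt_transition he he' hy
  apply ContDiffAt.contDiffWithinAt
  refine ContDiffAt.prodMk (hg.comp (y, ξ) contDiffAt_fst) ?_
  rw [contDiffAt_pi]
  intro i
  refine ContDiffAt.const_smul _ ?_
  have hev : (fun q : E × (Fin k → E) =>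
      iteratedDeriv (i + 1) ((e' ∘ e.symm) ∘ polyCurve q.1 q.2) 0) =ᶠ[𝓝 (y, ξ)]
      fun q => ∑ c : OrderedFinpartition ((i : ℕ) + 1),
        iteratedFDeriv ℝ c.length (e' ∘ e.symm) q.1 fun m =>
          (Nat.factorial (c.partSize m) : ℝ) • q.2 ⟨c.partSize m - 1, by
            have := c.partSize_pos m; have := c.partSize_le m; omega⟩ := by
    have hopen : IsOpen {q : E × (Fin k → E) | q.1 ∈ (e.symm.trans e').source} :=
      (e.symm.trans e').open_source.preimage continuous_fst
    filter_upwards [hopen.mem_nhds hy] with q hq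
    rw [iteratedDeriv_vcomp_eq_sum_orderedFinpartition (n := ∞)
      (by rw [polyCurve_zero]; exact contDiffAt_transition he he' hq)
      (contDiff_polyCurve E q.1 q.2).contDiffAt (by exact_mod_cast le_top), polyCurve_zero]
    refine Finset.sum_congr rfl fun c _ => ?_
    congr 1
    funext m
    have h1 := c.partSize_pos m
    have h2 := c.partSize_le m
    have := iteratedDeriv_polyCurve E q.1 q.2 ⟨c.partSize m - 1, by omega⟩
    simp only [Nat.sub_add_cancel h1] at this
    exact this
  refine ContDiffAt.congr_of_eventuallyEq ?_ hev
  refine ContDiffAt.sum fun c _ => ?_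
  have h1 : ContDiffAt ℝ ∞ (fun q : E × (Fin k → E) =>
      iteratedFDeriv ℝ c.length (e' ∘ e.symm) q.1) (y, ξ) :=
    (hg.iteratedFDeriv_right (m := ∞) (i := c.length) (by exact_mod_cast le_top)).comp
      (y, ξ) contDiffAt_fst
  refine contDiffAt_multilinear_apply h1 ?_
  fun_prop


/-- The manifold structure of `T^k M` given by the charts `oscChart`. -/
def oscCore (E M : Type*) [NormedAddCommGroup E] [NormedSpace ℝ E] [TopologicalSpace M]
    [ChartedSpace E M] [IsManifold 𝓘(ℝ, E) ∞ M] (k : ℕ) :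
    ChartedSpaceCore (E × (Fin k → E)) (OscBundle E M k) where
  atlas := {c | ∃ (e : OpenPartialHomeomorph M E) (he : e ∈ atlas E M), c = oscChart k e he}
  chartAt p := oscChart k (chartAt E p.proj) (chart_mem_atlas E p.proj)
  mem_chart_source p := mem_chart_source E p.proj
  chart_mem_atlas p := ⟨_, _, rfl⟩
  open_source := by
    rintro _ _ ⟨e, he, rfl⟩ ⟨e', he', rfl⟩
    rw [oscChart_trans_source]
    exact (e.symm.trans e').open_source.prod isOpen_univ
  continuousOn_toFun := by
    rintro _ _ ⟨e, he, rfl⟩ ⟨e', he', rfl⟩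
    exact (contDiffOn_oscChart_transition k he he').continuousOn

instance OscBundle.topologicalSpace [IsManifold 𝓘(ℝ, E) ∞ M] (k : ℕ) :
    TopologicalSpace (OscBundle E M k) :=
  (oscCore E M k).toTopologicalSpace

instance OscBundle.chartedSpace [IsManifold 𝓘(ℝ, E) ∞ M] (k : ℕ) :
    ChartedSpace (E × (Fin k → E)) (OscBundle E M k) :=
  (oscCore E M k).toChartedSpace

/-- `T^k M` is a smooth manifold. -/
instance OscBundle.isManifold [IsManifold 𝓘(ℝ, E) ∞ M] (k : ℕ) :
    IsManifold 𝓘(ℝ, E × (Fin k → E)) ∞ (OscBundle E M k) := by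
  apply isManifold_of_contDiffOn
  intro c c' hc hc'
  change c ∈ ⋃ (e) (_ : e ∈ (oscCore E M k).atlas), _ at hc
  change c' ∈ ⋃ (e) (_ : e ∈ (oscCore E M k).atlas), _ at hc'
  simp only [mem_iUnion, mem_singleton_iff] at hc hc'
  obtain ⟨_, ⟨e, he, rfl⟩, rfl⟩ := hc
  obtain ⟨_, ⟨e', he', rfl⟩, rfl⟩ := hc'
  have h := contDiffOn_oscChart_transition (M := M) k he he'
  refine h.mono ?_
  rintro q ⟨hq, -⟩
  exact hq

end Curves

section TangentPower

variable (E M : Type*) [NormedAddCommGroup E] [NormedSpace ℝ E] [TopologicalSpace M]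
  [ChartedSpace E M] [IsManifold 𝓘(ℝ, E) ∞ M]

variable {E} in
theorem contDiff_piMap (k : ℕ) : ContDiff ℝ ∞ (fun A : E →L[ℝ] E =>
    (ContinuousLinearMap.piMap fun _ => A : (Fin k → E) →L[ℝ] (Fin k → E))) := by
  have h : (fun A : E →L[ℝ] E =>
      (ContinuousLinearMap.piMap fun _ => A : (Fin k → E) →L[ℝ] (Fin k → E))) =
      fun A => ∑ a : Fin k, ((ContinuousLinearMap.single ℝ (fun _ : Fin k => E) a).comp A).comp
        (ContinuousLinearMap.proj (R := ℝ) (φ := fun _ : Fin k => E) a) := by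
    funext A
    ext v a
    simp [Pi.single_apply]
  rw [h]
  fun_prop

/-- The Whitney sum `⊕_{i=1}^k TM`: its transition maps act on each of the `k` components of
`E^k` as those of `TM`. -/
def tangentPowerCore (k : ℕ) : VectorBundleCore ℝ M (Fin k → E) (atlas E M) where
  baseSet := (tangentBundleCore 𝓘(ℝ, E) M).baseSet
  isOpen_baseSet := (tangentBundleCore 𝓘(ℝ, E) M).isOpen_baseSet
  indexAt := (tangentBundleCore 𝓘(ℝ, E) M).indexAt
  mem_baseSet_at := (tangentBundleCore 𝓘(ℝ, E) M).mem_baseSet_at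
  coordChange i j x :=
    ContinuousLinearMap.piMap fun _ => (tangentBundleCore 𝓘(ℝ, E) M).coordChange i j x
  coordChange_self i x hx v := by
    funext a
    exact (tangentBundleCore 𝓘(ℝ, E) M).coordChange_self i x hx (v a)
  continuousOn_coordChange i j :=
    (contDiff_piMap k).continuous.comp_continuousOn
      ((tangentBundleCore 𝓘(ℝ, E) M).continuousOn_coordChange i j)
  coordChange_comp i j l x hx v := by
    funext a
    exact (tangentBundleCore 𝓘(ℝ, E) M).coordChange_comp i j l x hx (v a)

instance tangentPowerCore.isContMDiff (k : ℕ) :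
    (tangentPowerCore E M k).IsContMDiff 𝓘(ℝ, E) ∞ where
  contMDiffOn_coordChange i j :=
    have : IsManifold 𝓘(ℝ, E) (∞ + 1) M := ‹IsManifold 𝓘(ℝ, E) ∞ M›
    have : (tangentBundleCore 𝓘(ℝ, E) M).IsContMDiff 𝓘(ℝ, E) ∞ := tangentBundleCore.isContMDiff
    (contDiff_piMap k).contMDiff.comp_contMDiffOn
      ((tangentBundleCore 𝓘(ℝ, E) M).contMDiffOn_coordChange 𝓘(ℝ, E) i j)

variable {M} in
/-- The fibre `⊕_{i=1}^k T_x M` of the Whitney sum. -/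
abbrev TangentPower (k : ℕ) : M → Type _ := (tangentPowerCore E M k).Fiber

end TangentPower

section VectorBundles

/-- An isomorphism of smooth vector bundles over `M` (covering the identity of `M`). -/
structure SmoothVectorBundleIso {E M : Type*} [NormedAddCommGroup E] [NormedSpace ℝ E]
    [TopologicalSpace M] [ChartedSpace E M]
    (F : Type*) [NormedAddCommGroup F] [NormedSpace ℝ F] (V : M → Type*)
    [∀ x, AddCommGroup (V x)] [∀ x, Module ℝ (V x)] [∀ x, TopologicalSpace (V x)]
    [TopologicalSpace (TotalSpace F V)] [FiberBundle F V]
    (F' : Type*) [NormedAddCommGroup F'] [NormedSpace ℝ F'] (V' : M → Type*)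
    [∀ x, AddCommGroup (V' x)] [∀ x, Module ℝ (V' x)] [∀ x, TopologicalSpace (V' x)]
    [TopologicalSpace (TotalSpace F' V')] [FiberBundle F' V'] where
  toFun : ∀ x, V x ≃L[ℝ] V' x
  contMDiff_toFun : ContMDiff (𝓘(ℝ, E).prod 𝓘(ℝ, F)) (𝓘(ℝ, E).prod 𝓘(ℝ, F')) ∞
    (fun p : TotalSpace F V => (⟨p.1, toFun p.1 p.2⟩ : TotalSpace F' V'))
  contMDiff_invFun : ContMDiff (𝓘(ℝ, E).prod 𝓘(ℝ, F')) (𝓘(ℝ, E).prod 𝓘(ℝ, F)) ∞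
    (fun p : TotalSpace F' V' => (⟨p.1, (toFun p.1).symm p.2⟩ : TotalSpace F V))

/-- A smooth vector bundle structure on `π_k : T^k M → M`, with fibres modelled on `E^k`: vector
space structures on the fibres `T_x^k M` and local trivializations with smooth transition maps,
such that the manifold structure which they define on the total space is the one of `T^k M`
(the last two fields: the identity map is a diffeomorphism). -/
class OscVectorBundle (E M : Type*) [NormedAddCommGroup E] [NormedSpace ℝ E]
    [TopologicalSpace M] [ChartedSpace E M] [IsManifold 𝓘(ℝ, E) ∞ M] (k : ℕ) where
  [addCommGroup : ∀ x : M, AddCommGroup (OscFiber E k x)]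
  [module : ∀ x : M, Module ℝ (OscFiber E k x)]
  [topologicalSpaceFiber : ∀ x : M, TopologicalSpace (OscFiber E k x)]
  [topologicalSpaceTotal :
    TopologicalSpace (TotalSpace (Fin k → E) (OscFiber E k : M → Type _))]
  [fiberBundle : FiberBundle (Fin k → E) (OscFiber E k : M → Type _)]
  [vectorBundle : VectorBundle ℝ (Fin k → E) (OscFiber E k : M → Type _)]
  [contMDiffVectorBundle :
    ContMDiffVectorBundle ∞ (Fin k → E) (OscFiber E k : M → Type _) 𝓘(ℝ, E)]
  contMDiff_toTotalSpace :
    ContMDiff 𝓘(ℝ, E × (Fin k → E)) (𝓘(ℝ, E).prod 𝓘(ℝ, Fin k → E)) ∞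
      (fun p : OscBundle E M k =>
        (⟨p.proj, p.jet⟩ : TotalSpace (Fin k → E) (OscFiber E k : M → Type _)))
  contMDiff_ofTotalSpace :
    ContMDiff (𝓘(ℝ, E).prod 𝓘(ℝ, Fin k → E)) 𝓘(ℝ, E × (Fin k → E)) ∞
      (fun p : TotalSpace (Fin k → E) (OscFiber E k : M → Type _) =>
        (⟨p.proj, p.snd⟩ : OscBundle E M k))

attribute [reducible] OscVectorBundle.addCommGroup OscVectorBundle.module
  OscVectorBundle.topologicalSpaceFiber OscVectorBundle.topologicalSpaceTotal
  OscVectorBundle.fiberBundle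

attribute [instance] OscVectorBundle.addCommGroup OscVectorBundle.module
  OscVectorBundle.topologicalSpaceFiber OscVectorBundle.topologicalSpaceTotal
  OscVectorBundle.fiberBundle OscVectorBundle.vectorBundle
  OscVectorBundle.contMDiffVectorBundle

end VectorBundles

section Connections

variable (E M : Type*) [NormedAddCommGroup E] [NormedSpace ℝ E] [TopologicalSpace M]
  [ChartedSpace E M]

variable {E M} in
/-- The chart of `TM` induced by a chart `e` of `M`, as a map `v ↦ (e (τ v), de v)`. -/
def tangentChart [IsManifold 𝓘(ℝ, E) ∞ M] (e : OpenPartialHomeomorph M E)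
    (v : TangentBundle 𝓘(ℝ, E) M) : E × E :=
  (e v.proj, mfderiv 𝓘(ℝ, E) 𝓘(ℝ, E) e v.proj v.2)

/-- A (smooth) linear connection on `M`: a vector bundle morphism `K : T(TM) → TM` over
`τ : TM → M` which in every chart `e : U → E` of the atlas has the local form
`K_e (x, ξ; y, η) = (x, η + Γ_e(x)(ξ) y)` with a smooth local component
`Γ_e : e(U) → L(E, L(E, E))`. -/
structure LinearConnection [IsManifold 𝓘(ℝ, E) ∞ M] where
  toFun : ∀ v : TangentBundle 𝓘(ℝ, E) M,
    TangentSpace 𝓘(ℝ, E).tangent v →L[ℝ] TangentSpace 𝓘(ℝ, E) v.proj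
  exists_local : ∀ e ∈ atlas E M, ∃ Γ : E → E →L[ℝ] E →L[ℝ] E,
    ContDiffOn ℝ ∞ Γ e.target ∧
    ∀ (v : TangentBundle 𝓘(ℝ, E) M), v.proj ∈ e.source →
      ∀ w : TangentSpace 𝓘(ℝ, E).tangent v,
        letI x : E := (tangentChart e v).1
        letI ξ : E := (tangentChart e v).2
        letI dw : E × E := mfderiv 𝓘(ℝ, E).tangent 𝓘(ℝ, E × E) (tangentChart e) v w
        mfderiv 𝓘(ℝ, E) 𝓘(ℝ, E) e v.proj (toFun v w) = dw.2 + Γ x ξ dw.1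

/-- `M` is `C^n`-partitionable: it is Hausdorff and paracompact, and every open cover of `M` has a
subordinate partition of unity of class `C^n`. -/
structure IsPartitionable (n : ℕ∞) : Prop where
  t2 : T2Space M
  paracompact : ParacompactSpace M
  exists_partition : ∀ 𝒰 : Set (Set M), (∀ U ∈ 𝒰, IsOpen U) → ⋃₀ 𝒰 = univ →
    ∃ f : PartitionOfUnity 𝒰 M, f.IsSubordinate (fun U => (U : Set M)) ∧
      ∀ i, ContMDiff 𝓘(ℝ, E) 𝓘(ℝ, ℝ) n (f i)

end Connections

end

noncomputable section

/-! In a chart of `M`, let `f_y` send the chart coordinates `ξ = (ξ₁, …, ξ_k)` of a jet over `y` to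
its coordinates in a local trivialization of `T^k M`. The map `f_y` is a diffeomorphism of `E^k`, in
general not linear, and its second derivative measures how far the linear structure of the fibre is
from that of the chart. Let `φ` be a change of charts, `T` the map it induces on the jet coordinates
over `y`, and `G` the linear change of trivializations, so that `f₂ ∘ T = G ∘ f₁`. The constant jet
has coordinates `0` in every chart, so `T 0 = 0`. Differentiating twice at `0` and eliminating `G`
gives `T'(f₁'⁻¹ f₁''(a, b)) = T''(a, b) + f₂'⁻¹ f₂''(T' a, T' b)`, all derivatives being taken at
`0`. It does not matter whether `f₁` and `f₂` vanish at `0`.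

Only orders one and two are needed. Let `ι` be the inclusion of the `ξ₁` axis and `P` the projection
to `ξ₂`. Then `T'(0) ι = ι φ'(y)`, because a rescaling of the parameter multiplies `ξ_i` by `s^i`.
Moreover `T` has second component `φ'(y) ξ₂ + ½ φ''(y)(ξ₁, ξ₁)`, so that `P T'(0) = φ'(y) P` and `P
T''(0)(ι u, ι v) = φ''(y)(u, v)`. Hence `Γ(u, v) = P f'(0)⁻¹ f''(0)(ι u, ι v)` satisfies `φ'(Γ(u,
v)) = φ''(u, v) + Γ'(φ' u, φ' v)`, where `Γ'` belongs to the second chart. This is the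
transformation law of Christoffel symbols.

The identity is `fibreChristoffel_transform`, and `oscChristoffel_transition` applies it to `T^k M`.
With `φ = id` it shows that `Γ` does not depend on the trivialization (`oscChristoffel_congr`).
Finally `LinearConnection.ofChristoffel` glues the local components. -/

theorem two_le_infty : (2 : ℕ∞ω) ≤ ∞ := WithTop.coe_le_coe.2 le_top

/-! ### Calculus: second derivatives of compositions and rescaled curves -/

section SecondDerivative

variable {E F G : Type*} [NormedAddCommGroup E] [NormedSpace ℝ E]
  [NormedAddCommGroup F] [NormedSpace ℝ F] [NormedAddCommGroup G] [NormedSpace ℝ G]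

/-- The chain rule for second derivatives. -/
theorem fderiv_fderiv_comp_apply {g : F → G} {f : E → F} {x : E}
    (hg : ContDiffAt ℝ 2 g (f x)) (hf : ContDiffAt ℝ 2 f x) (u v : E) :
    fderiv ℝ (fderiv ℝ (g ∘ f)) x u v =
      fderiv ℝ (fderiv ℝ g) (f x) (fderiv ℝ f x u) (fderiv ℝ f x v) +
        fderiv ℝ g (f x) (fderiv ℝ (fderiv ℝ f) x u v) := by
  -- Differentiating once more requires the chain rule at all points near `x`; being `C²` at a point
  -- is an open condition.
  have hev : fderiv ℝ (g ∘ f) =ᶠ[𝓝 x] fun y => (fderiv ℝ g (f y)).comp (fderiv ℝ f y) := by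
    have h1 : ∀ᶠ y in 𝓝 x, ContDiffAt ℝ 2 g (f y) :=
      hf.continuousAt.eventually (hg.eventually (by simp))
    filter_upwards [h1, hf.eventually (by simp)] with y hy1 hy2
    exact fderiv_comp y (hy1.differentiableAt (by simp)) (hy2.differentiableAt (by simp))
  have hg1 : DifferentiableAt ℝ (fderiv ℝ g) (f x) :=
    (hg.fderiv_right (m := 1) (by norm_num)).differentiableAt (by simp)
  have hf1 : DifferentiableAt ℝ (fderiv ℝ f) x :=
    (hf.fderiv_right (m := 1) (by norm_num)).differentiableAt (by simp)
  have h := (hg1.hasFDerivAt.comp x (hf.differentiableAt (by simp)).hasFDerivAt).clm_comp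
    hf1.hasFDerivAt
  rw [hev.fderiv_eq]
  erw [h.fderiv]
  simp [add_comm]

theorem fderiv_fderiv_clm_comp_apply {f : E → F} {x : E} (L : F →L[ℝ] G)
    (hf : ContDiffAt ℝ 2 f x) (u v : E) :
    fderiv ℝ (fderiv ℝ (L ∘ f)) x u v = L (fderiv ℝ (fderiv ℝ f) x u v) := by
  rw [fderiv_fderiv_comp_apply L.contDiff.contDiffAt hf]
  have : fderiv ℝ (L : F → G) = fun _ => L := funext fun _ => L.fderiv
  simp [this]

/-- Rescaling the parameter of a curve. -/
theorem iteratedDeriv_comp_mul_left (f : ℝ → F) (c : ℝ) (n : ℕ) :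
    iteratedDeriv n (fun t => f (c * t)) = fun t => c ^ n • iteratedDeriv n f (c * t) := by
  induction n with
  | zero => simp
  | succ n ih =>
    funext t
    rw [iteratedDeriv_succ, ih, deriv_fun_const_smul_field, iteratedDeriv_succ]
    have := deriv_comp_mul_left c (iteratedDeriv n f) t
    rw [this, smul_smul, pow_succ]

end SecondDerivative

/-! ### The Christoffel map of a nonlinear change of fibre coordinates -/

section FibreChristoffel

variable {E F F₁ F₂ : Type*} [NormedAddCommGroup E] [NormedSpace ℝ E]
  [NormedAddCommGroup F] [NormedSpace ℝ F] [NormedAddCommGroup F₁] [NormedSpace ℝ F₁]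
  [NormedAddCommGroup F₂] [NormedSpace ℝ F₂]

/-- The bilinear map `(u, v) ↦ P (f'(0)⁻¹ (f''(0) (ι u, ι v)))`. -/
def fibreChristoffel (ι : E →L[ℝ] F) (P : F →L[ℝ] E) (f : F → F₁) : E →L[ℝ] E →L[ℝ] E :=
  ((ContinuousLinearMap.compL ℝ E F₁ E (P ∘L (fderiv ℝ f 0).inverse)) ∘L
    ((ContinuousLinearMap.compL ℝ E F F₁).flip ι)) ∘L (fderiv ℝ (fderiv ℝ f) 0 ∘L ι)

theorem fibreChristoffel_apply (ι : E →L[ℝ] F) (P : F →L[ℝ] E) (f : F → F₁) (u v : E) :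
    fibreChristoffel ι P f u v =
      P ((fderiv ℝ f 0).inverse (fderiv ℝ (fderiv ℝ f) 0 (ι u) (ι v))) := by
  simp [fibreChristoffel]

/-- Behaviour of `fibreChristoffel` under a change `T` of fibre coordinates and a linear
isomorphism `G`. -/
theorem fibreChristoffel_transform {ι : E →L[ℝ] F} {P : F →L[ℝ] E} {f₁ : F → F₁} {f₂ : F → F₂}
    {T : F → F} {G : F₁ ≃L[ℝ] F₂} {L : E →L[ℝ] E}
    (h₁ : ContDiffAt ℝ 2 f₁ 0) (h₂ : ContDiffAt ℝ 2 f₂ 0) (hT : ContDiffAt ℝ 2 T 0)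
    (hT0 : T 0 = 0) (hcomp : f₂ ∘ T = G ∘ f₁)
    (hi₁ : (fderiv ℝ f₁ 0).IsInvertible) (hi₂ : (fderiv ℝ f₂ 0).IsInvertible)
    (hι : ∀ u, fderiv ℝ T 0 (ι u) = ι (L u)) (hP : ∀ ξ, P (fderiv ℝ T 0 ξ) = L (P ξ)) (u v : E) :
    L (fibreChristoffel ι P f₁ u v) =
      fderiv ℝ (fderiv ℝ (P ∘ T)) 0 (ι u) (ι v) + fibreChristoffel ι P f₂ (L u) (L v) := by
  have h₂' : ContDiffAt ℝ 2 f₂ (T 0) := by rwa [hT0]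
  have hA : ∀ ξ, fderiv ℝ f₂ 0 (fderiv ℝ T 0 ξ) = G (fderiv ℝ f₁ 0 ξ) := by
    intro ξ
    have h := congrArg (fun g => fderiv ℝ g 0 ξ) hcomp
    rw [fderiv_comp 0 (h₂'.differentiableAt (by simp)) (hT.differentiableAt (by simp)),
      G.comp_fderiv, hT0] at h
    exact h
  -- The second derivative of the intertwining relation; `G` is linear and contributes no
  -- second-order term.
  have hB := congrArg (fun g => fderiv ℝ (fderiv ℝ g) 0 (ι u) (ι v)) hcomp
  have hG := fderiv_fderiv_clm_comp_apply (G : F₁ →L[ℝ] F₂) h₁ (ι u) (ι v)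
  change _ = fderiv ℝ (fderiv ℝ ((G : F₁ →L[ℝ] F₂) ∘ f₁)) 0 (ι u) (ι v) at hB
  rw [hG, fderiv_fderiv_comp_apply h₂' hT, hT0, hι, hι] at hB
  rw [fibreChristoffel_apply, fibreChristoffel_apply, fderiv_fderiv_clm_comp_apply P hT, ← hP]
  -- Writing the second derivative of `f₁` as `f₁'(0) w` turns `G f₁'(0) w` into `f₂'(0) T'(0) w`.
  -- The claim can then be checked after applying the injective map `f₂'(0)`.
  obtain ⟨w, hw⟩ := hi₁.surjective (fderiv ℝ (fderiv ℝ f₁) 0 (ι u) (ι v))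
  rw [← hw, hi₁.inverse_apply_self, ← map_add]
  rw [← hw, ContinuousLinearEquiv.coe_coe, ← hA] at hB
  congr 1
  apply hi₂.injective
  rw [← hB, map_add, hi₂.self_apply_inverse, add_comm]

set_option synthInstance.maxHeartbeats 200000 in
/-- `fibreChristoffel` depends smoothly on parameters. -/
theorem contDiffAt_fibreChristoffel [CompleteSpace F] {X : Type*} [NormedAddCommGroup X]
    [NormedSpace ℝ X] (ι : E →L[ℝ] F) (P : F →L[ℝ] E) {f : X → F → F₁} {x : X}
    (hf : ContDiffAt ℝ ∞ (fun q : X × F => f q.1 q.2) (x, 0))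
    (hi : (fderiv ℝ (f x) 0).IsInvertible) :
    ContDiffAt ℝ ∞ (fun y => fibreChristoffel ι P (f y)) x := by
  have hA' : ContDiffAt ℝ ∞ (fun q : X × F => fderiv ℝ (f q.1) q.2) (x, 0) := by
    refine ContDiffAt.fderiv (n := ∞) (f := fun (q : X × F) ξ => f q.1 ξ) (g := Prod.snd) ?_
      contDiffAt_snd le_rfl
    exact ContDiffAt.comp (f := fun p : (X × F) × F => (p.1.1, p.2)) ((x, (0 : F)), (0 : F)) hf
      (by fun_prop)
  have hA : ContDiffAt ℝ ∞ (fun y => fderiv ℝ (f y) 0) x :=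
    ContDiffAt.comp (f := fun y : X => (y, (0 : F))) x hA' (by fun_prop)
  have hB : ContDiffAt ℝ ∞ (fun y => fderiv ℝ (fderiv ℝ (f y)) 0) x :=
    ContDiffAt.fderiv (n := ∞) (f := fun y ξ => fderiv ℝ (f y) ξ) (g := fun _ => (0 : F)) hA'
      contDiffAt_const le_rfl
  -- Inversion of operators is smooth near an invertible one; completeness of `F` enters here.
  have hinv : ContDiffAt ℝ ∞ (fun y => (fderiv ℝ (f y) 0).inverse) x := by
    obtain ⟨e, he⟩ := hi
    have := contDiffAt_map_inverse (n := ∞) e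
    rw [he] at this
    exact this.comp x hA
  have hQ : ContDiffAt ℝ ∞ (fun y => ContinuousLinearMap.compL ℝ E F₁ E
      (P ∘L (fderiv ℝ (f y) 0).inverse)) x := by
    have hc : ContDiff ℝ ∞ (ContinuousLinearMap.compL ℝ E F₁ E) := by fun_prop
    exact hc.contDiffAt.comp x (contDiffAt_const.clm_comp hinv)
  exact (hQ.clm_comp contDiffAt_const).clm_comp (hB.clm_comp contDiffAt_const)

end FibreChristoffel

/-! ### Jet coordinates of order one and two under a change of charts -/

section JetCoordinates

variable {E : Type*} [NormedAddCommGroup E] [NormedSpace ℝ E]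

/-- The coordinates of order `1, …, k` at `0` of the image under `φ` of a polynomial curve. -/
def jetMap (k : ℕ) (φ : E → E) (y : E) (ξ : Fin k → E) : Fin k → E :=
  fun i => ((Nat.factorial (i + 1) : ℝ)⁻¹) • iteratedDeriv (i + 1) (φ ∘ polyCurve y ξ) 0

theorem jetMap_zero {k : ℕ} (φ : E → E) (y : E) : jetMap k φ y 0 = 0 := by
  have h : φ ∘ polyCurve y (0 : Fin k → E) = fun _ => φ y := by
    funext t
    simp [polyCurve]
  funext i
  simp [jetMap, h, iteratedDeriv_const]

theorem hasDerivAt_polyCurve_zero {k : ℕ} (hk : 0 < k) (y : E) (ξ : Fin k → E) :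
    HasDerivAt (polyCurve y ξ) (ξ ⟨0, hk⟩) 0 := by
  have h := iteratedDeriv_polyCurve E y ξ ⟨0, hk⟩
  simp only [zero_add, iteratedDeriv_one, Nat.factorial_one, Nat.cast_one, one_smul] at h
  rw [← h]
  exact ((contDiff_polyCurve E y ξ).differentiable (by simp) 0).hasDerivAt

theorem jetMap_first {k : ℕ} (hk : 0 < k) {φ : E → E} {y : E} (hφ : DifferentiableAt ℝ φ y)
    (ξ : Fin k → E) : jetMap k φ y ξ ⟨0, hk⟩ = fderiv ℝ φ y (ξ ⟨0, hk⟩) := by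
  have h : HasFDerivAt φ (fderiv ℝ φ y) (polyCurve y ξ 0) := by
    rw [polyCurve_zero]; exact hφ.hasFDerivAt
  have := (h.comp_hasDerivAt 0 (hasDerivAt_polyCurve_zero hk y ξ)).deriv
  simp [jetMap, this]

theorem jetMap_second {k : ℕ} (hk : 1 < k) {φ : E → E} {y : E} (hφ : ContDiffAt ℝ 2 φ y)
    (ξ : Fin k → E) : jetMap k φ y ξ ⟨1, hk⟩ = fderiv ℝ φ y (ξ ⟨1, hk⟩) +
      (2 : ℝ)⁻¹ • fderiv ℝ (fderiv ℝ φ) y (ξ ⟨0, by omega⟩) (ξ ⟨0, by omega⟩) := by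
  have h := iteratedDeriv_vcomp_two (g := φ) (f := polyCurve y ξ) (x := 0)
    (by rwa [polyCurve_zero]) ((contDiff_polyCurve E y ξ).of_le (m := 2) two_le_infty).contDiffAt
  have h2 := iteratedDeriv_polyCurve E y ξ ⟨1, hk⟩
  simp only [Nat.reduceAdd] at h2
  rw [polyCurve_zero, (hasDerivAt_polyCurve_zero (by omega) y ξ).deriv, h2,
    iteratedFDeriv_two_apply] at h
  simp only [jetMap, Nat.reduceAdd, h]
  simp [Nat.factorial, smul_smul, add_comm]

/-- The `ξ₁` axis consists of the lines `t ↦ y + t u`. Scaling `u` by `s` amounts to replacing `t`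
by `s t`, and a derivative of order `i + 1` picks up the factor `s ^ (i + 1)`. -/
theorem jetMap_single_smul {k : ℕ} (hk : 0 < k) (φ : E → E) (y u : E) (s : ℝ) (i : Fin k) :
    jetMap k φ y (Pi.single ⟨0, hk⟩ (s • u)) i =
      s ^ ((i : ℕ) + 1) • jetMap k φ y (Pi.single ⟨0, hk⟩ u) i := by
  have hp : ∀ u : E, polyCurve y (Pi.single ⟨0, hk⟩ u : Fin k → E) = fun t => y + t • u := by
    intro u
    funext t
    rw [polyCurve, Finset.sum_eq_single ⟨0, hk⟩]
    · simp
    · intro b _ hb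
      simp [hb]
    · simp
  have h : φ ∘ polyCurve y (Pi.single ⟨0, hk⟩ (s • u) : Fin k → E) =
      fun t => (φ ∘ polyCurve y (Pi.single ⟨0, hk⟩ u : Fin k → E)) (s * t) := by
    funext t
    simp [hp, smul_smul, mul_comm]
  simp only [jetMap]
  rw [h, iteratedDeriv_comp_mul_left]
  simp only [mul_zero]
  rw [smul_comm]

/-- By homogeneity, component `i` along the `ξ₁` axis is a multiple of `s ^ (i + 1)`, whose
derivative at `s = 0` vanishes unless `i = 0`. No formula for the higher components is needed. -/
theorem fderiv_jetMap_single {k : ℕ} (hk : 0 < k) {φ : E → E} {y : E}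
    (hφ : DifferentiableAt ℝ φ y) (hT : DifferentiableAt ℝ (jetMap k φ y) 0) (u : E) :
    fderiv ℝ (jetMap k φ y) 0 (Pi.single ⟨0, hk⟩ u) = Pi.single ⟨0, hk⟩ (fderiv ℝ φ y u) := by
  have h1 : HasDerivAt (fun s : ℝ => (Pi.single ⟨0, hk⟩ (s • u) : Fin k → E))
      (Pi.single ⟨0, hk⟩ u) 0 := by
    have := (ContinuousLinearMap.single ℝ (fun _ : Fin k => E) ⟨0, hk⟩).hasFDerivAt.comp_hasDerivAt
      (0 : ℝ) ((hasDerivAt_id (0 : ℝ)).smul_const u)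
    rw [one_smul] at this
    exact this
  have h2 : HasFDerivAt (jetMap k φ y) (fderiv ℝ (jetMap k φ y) 0)
      (Pi.single ⟨0, hk⟩ ((0 : ℝ) • u) : Fin k → E) := by
    simpa using hT.hasFDerivAt
  have h3 := h2.comp_hasDerivAt (0 : ℝ) h1
  funext i
  have h4 := (hasDerivAt_pi.1 h3 i).deriv
  rw [← h4]
  have h5 : (fun s : ℝ => (jetMap k φ y ∘ fun s : ℝ => (Pi.single ⟨0, hk⟩ (s • u) : Fin k → E)) s i)
      = fun s => s ^ ((i : ℕ) + 1) • jetMap k φ y (Pi.single ⟨0, hk⟩ u) i :=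
    funext fun s => jetMap_single_smul hk φ y u s i
  rw [h5, deriv_smul_const (by fun_prop)]
  by_cases hi : i = ⟨0, hk⟩
  · subst hi
    rw [jetMap_first hk hφ]
    simp
  · have : (i : ℕ) ≠ 0 := fun h => hi (Fin.ext h)
    simp [hi, this]

variable {k : ℕ} (hk : 1 < k) {φ : E → E} {y : E}

theorem jetMap_second_eq (hφ : ContDiffAt ℝ 2 φ y) :
    (ContinuousLinearMap.proj (R := ℝ) (φ := fun _ : Fin k => E) ⟨1, hk⟩) ∘ jetMap k φ y =
      fun ξ => fderiv ℝ φ y (ξ ⟨1, hk⟩) +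
        (2 : ℝ)⁻¹ • fderiv ℝ (fderiv ℝ φ) y (ξ ⟨0, by omega⟩) (ξ ⟨0, by omega⟩) :=
  funext fun ξ => jetMap_second hk hφ ξ

theorem hasFDerivAt_jetMap_second (hφ : ContDiffAt ℝ 2 φ y) (ξ : Fin k → E) :
    HasFDerivAt ((ContinuousLinearMap.proj (R := ℝ) (φ := fun _ : Fin k => E) ⟨1, hk⟩) ∘
        jetMap k φ y)
      (fderiv ℝ φ y ∘L ContinuousLinearMap.proj (R := ℝ) (φ := fun _ : Fin k => E) ⟨1, hk⟩ +
        fderiv ℝ (fderiv ℝ φ) y (ξ ⟨0, by omega⟩) ∘L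
          ContinuousLinearMap.proj (R := ℝ) (φ := fun _ : Fin k => E) ⟨0, by omega⟩) ξ := by
  rw [jetMap_second_eq hk hφ]
  -- Symmetry of `φ''` merges the two halves obtained by differentiating `½ φ''(ξ₁, ξ₁)`.
  have hs : IsSymmSndFDerivAt ℝ φ y := hφ.isSymmSndFDerivAt (by simp)
  have h0 := (ContinuousLinearMap.proj (R := ℝ) (φ := fun _ : Fin k => E)
    ⟨0, by omega⟩).hasFDerivAt (x := ξ)
  have h1 := (ContinuousLinearMap.proj (R := ℝ) (φ := fun _ : Fin k => E)
    ⟨1, hk⟩).hasFDerivAt (x := ξ)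
  have h := ((fderiv ℝ φ y).hasFDerivAt.comp ξ h1).add
    ((((fderiv ℝ (fderiv ℝ φ) y).hasFDerivAt.comp ξ h0).clm_apply h0).const_smul (2 : ℝ)⁻¹)
  refine h.congr_fderiv ?_
  ext v
  have := hs (ξ ⟨0, by omega⟩) (v ⟨0, by omega⟩)
  simp [this, ← two_smul ℝ]

set_option synthInstance.maxHeartbeats 200000 in
-- The factor `½` cancels against the two ways of differentiating the quadratic term. This puts
-- exactly `φ''` into the transformation law.
theorem fderiv_fderiv_jetMap_second (hφ : ContDiffAt ℝ 2 φ y) (u v : Fin k → E) :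
    fderiv ℝ (fderiv ℝ ((ContinuousLinearMap.proj (R := ℝ) (φ := fun _ : Fin k => E) ⟨1, hk⟩) ∘
        jetMap k φ y)) 0 u v =
      fderiv ℝ (fderiv ℝ φ) y (u ⟨0, by omega⟩) (v ⟨0, by omega⟩) := by
  have h : fderiv ℝ ((ContinuousLinearMap.proj (R := ℝ) (φ := fun _ : Fin k => E) ⟨1, hk⟩) ∘
      jetMap k φ y) = fun ξ => _ :=
    funext fun ξ => (hasFDerivAt_jetMap_second hk hφ ξ).fderiv
  rw [h]
  have h0 := (ContinuousLinearMap.proj (R := ℝ) (φ := fun _ : Fin k => E)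
    ⟨0, by omega⟩).hasFDerivAt (x := 0)
  have h2 := (((fderiv ℝ (fderiv ℝ φ) y).hasFDerivAt.comp 0 h0).clm_comp
    (hasFDerivAt_const (ContinuousLinearMap.proj (R := ℝ) (φ := fun _ : Fin k => E)
      ⟨0, by omega⟩) (0 : Fin k → E))).const_add
    (fderiv ℝ φ y ∘L ContinuousLinearMap.proj (R := ℝ) (φ := fun _ : Fin k => E) ⟨1, hk⟩)
  erw [h2.fderiv]
  simp

end JetCoordinates

/-! ### Gluing Christoffel symbols to a linear connection -/

section LinearConnections

variable {E M : Type*} [NormedAddCommGroup E] [NormedSpace ℝ E] [TopologicalSpace M]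
  [ChartedSpace E M] [IsManifold 𝓘(ℝ, E) ∞ M]

theorem contMDiffOn_tangentChart {e : OpenPartialHomeomorph M E} (he : e ∈ atlas E M) :
    ContMDiffOn 𝓘(ℝ, E).tangent 𝓘(ℝ, E × E) ∞ (tangentChart e)
      (TotalSpace.proj ⁻¹' e.source : Set (TangentBundle 𝓘(ℝ, E) M)) := by
  have h1 : ContMDiffOn 𝓘(ℝ, E) 𝓘(ℝ, E) ∞ e e.source :=
    contMDiffOn_of_mem_maximalAtlas (IsManifold.subset_maximalAtlas he)
  have h2 := h1.contMDiffOn_tangentMapWithin (m := ∞) (by simp) e.open_source.uniqueMDiffOn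
  have h3 : ContMDiffOn 𝓘(ℝ, E).tangent 𝓘(ℝ, E).tangent ∞ (tangentMap 𝓘(ℝ, E) 𝓘(ℝ, E) e)
      (TotalSpace.proj ⁻¹' e.source : Set (TangentBundle 𝓘(ℝ, E) M)) := by
    refine h2.congr fun v hv => ?_
    simp only [tangentMap, tangentMapWithin]
    rw [mfderivWithin_of_isOpen e.open_source hv]
  have h4 := (contMDiff_snd_tangentBundle_modelSpace (n := ∞) E 𝓘(ℝ, E)).comp_contMDiffOn h3
  have h5 := h1.comp (contMDiff_proj (IB := 𝓘(ℝ, E)) (n := ∞) (F := E)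
    (TangentSpace 𝓘(ℝ, E) : M → Type _)).contMDiffOn (subset_refl _)
  exact h5.prodMk_space h4

theorem mdifferentiableAt_tangentChart {e : OpenPartialHomeomorph M E} (he : e ∈ atlas E M)
    {v : TangentBundle 𝓘(ℝ, E) M} (hv : v.proj ∈ e.source) :
    MDifferentiableAt 𝓘(ℝ, E).tangent 𝓘(ℝ, E × E) (tangentChart e) v :=
  ((contMDiffOn_tangentChart he).contMDiffAt
    ((e.open_source.preimage (FiberBundle.continuous_proj E
      (TangentSpace 𝓘(ℝ, E) : M → Type _))).mem_nhds hv)).mdifferentiableAt (by simp)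

/-- The map induced by `φ : E → E` on `TE = E × E`. -/
def tangentTransition (φ : E → E) (q : E × E) : E × E := (φ q.1, fderiv ℝ φ q.1 q.2)

/-- The `φ''` summand is the inhomogeneous term which the Christoffel symbols have to compensate. -/
theorem hasFDerivAt_tangentTransition {φ : E → E} {q : E × E} (hφ : ContDiffAt ℝ 2 φ q.1) :
    HasFDerivAt (tangentTransition φ)
      ((fderiv ℝ φ q.1 ∘L ContinuousLinearMap.fst ℝ E E).prod
        (fderiv ℝ φ q.1 ∘L ContinuousLinearMap.snd ℝ E E +
          ((fderiv ℝ (fderiv ℝ φ) q.1).flip q.2) ∘L ContinuousLinearMap.fst ℝ E E)) q := by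
  have h1 : DifferentiableAt ℝ (fderiv ℝ φ) q.1 :=
    (hφ.fderiv_right (m := 1) (by norm_num)).differentiableAt (by simp)
  have h2 := (hφ.differentiableAt (by simp)).hasFDerivAt.comp q hasFDerivAt_fst
  exact h2.prodMk ((h1.hasFDerivAt.comp q hasFDerivAt_fst).clm_apply hasFDerivAt_snd)

theorem mfderiv_chart_eq {e e' : OpenPartialHomeomorph M E} (he : e ∈ atlas E M)
    (he' : e' ∈ atlas E M) {x : M} (hx : x ∈ e.source) (hx' : x ∈ e'.source)
    (z : TangentSpace 𝓘(ℝ, E) x) :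
    (mfderiv 𝓘(ℝ, E) 𝓘(ℝ, E) e' x z : E) =
      fderiv ℝ (e' ∘ e.symm) (e x) (mfderiv 𝓘(ℝ, E) 𝓘(ℝ, E) e x z : E) := by
  have hev : e' =ᶠ[𝓝 x] (e' ∘ e.symm) ∘ e := by
    filter_upwards [e.open_source.mem_nhds hx] with z hz
    simp [e.left_inv hz]
  have h1 : MDifferentiableAt 𝓘(ℝ, E) 𝓘(ℝ, E) e x :=
    (mdifferentiable_of_mem_atlas (I := 𝓘(ℝ, E)) he).mdifferentiableAt hx
  have h2 : DifferentiableAt ℝ (e' ∘ e.symm) (e x) :=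
    (contDiffAt_transition he he' (by simp [hx, hx'])).differentiableAt (by simp)
  rw [hev.mfderiv_eq, mfderiv_comp x h2.mdifferentiableAt h1, mfderiv_eq_fderiv]
  rfl

theorem mfderiv_tangentChart_eq {e e' : OpenPartialHomeomorph M E} (he : e ∈ atlas E M)
    (he' : e' ∈ atlas E M) {v : TangentBundle 𝓘(ℝ, E) M} (hv : v.proj ∈ e.source)
    (hv' : v.proj ∈ e'.source) (w : TangentSpace 𝓘(ℝ, E).tangent v) :
    (mfderiv 𝓘(ℝ, E).tangent 𝓘(ℝ, E × E) (tangentChart e') v w : E × E) =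
      fderiv ℝ (tangentTransition (e' ∘ e.symm)) (tangentChart e v)
        (mfderiv 𝓘(ℝ, E).tangent 𝓘(ℝ, E × E) (tangentChart e) v w : E × E) := by
  have hev : tangentChart e' =ᶠ[𝓝 v] tangentTransition (e' ∘ e.symm) ∘ tangentChart e := by
    have hc := FiberBundle.continuous_proj E (TangentSpace 𝓘(ℝ, E) : M → Type _)
    filter_upwards [(e.open_source.preimage hc).mem_nhds hv,
      (e'.open_source.preimage hc).mem_nhds hv'] with z hz hz'
    refine Prod.ext ?_ (mfderiv_chart_eq he he' hz hz' z.2)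
    simp [tangentChart, tangentTransition, e.left_inv hz]
  have h2 : DifferentiableAt ℝ (tangentTransition (e' ∘ e.symm)) (tangentChart e v) :=
    (hasFDerivAt_tangentTransition ((contDiffAt_transition he he'
      (by simp [tangentChart, hv, hv'])).of_le two_le_infty)).differentiableAt
  rw [hev.mfderiv_eq, mfderiv_comp v h2.mdifferentiableAt (mdifferentiableAt_tangentChart he hv),
    mfderiv_eq_fderiv]
  rfl

/-- Local components which are smooth and transform like Christoffel symbols define a linear
connection. -/
def LinearConnection.ofChristoffel
    (Γ : ∀ e : OpenPartialHomeomorph M E, e ∈ atlas E M → E → E →L[ℝ] E →L[ℝ] E)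
    (hΓ : ∀ e he, ContDiffOn ℝ ∞ (Γ e he) e.target)
    (hT : ∀ (e : OpenPartialHomeomorph M E) (he : e ∈ atlas E M)
      (e' : OpenPartialHomeomorph M E) (he' : e' ∈ atlas E M), ∀ y ∈ (e.symm.trans e').source, ∀ u v,
      fderiv ℝ (e' ∘ e.symm) y (Γ e he y u v) = fderiv ℝ (fderiv ℝ (e' ∘ e.symm)) y u v +
        Γ e' he' ((e' ∘ e.symm) y) (fderiv ℝ (e' ∘ e.symm) y u) (fderiv ℝ (e' ∘ e.symm) y v)) :
    LinearConnection E M where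
  -- The local formula in the preferred chart at the base point of `v`, solved for the connection by
  -- inverting the derivative of that chart.
  toFun v :=
    (((mdifferentiable_of_mem_atlas (I := 𝓘(ℝ, E)) (chart_mem_atlas E v.proj)).mfderiv
      (mem_chart_source E v.proj)).symm : TangentSpace 𝓘(ℝ, E) (chartAt E v.proj v.proj) →L[ℝ] _) ∘L
    ((ContinuousLinearMap.snd ℝ E E + Γ (chartAt E v.proj) (chart_mem_atlas E v.proj)
      (tangentChart (chartAt E v.proj) v).1 (tangentChart (chartAt E v.proj) v).2 ∘L
        ContinuousLinearMap.fst ℝ E E) ∘L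
      mfderiv 𝓘(ℝ, E).tangent 𝓘(ℝ, E × E) (tangentChart (chartAt E v.proj)) v)
  exists_local e' he' := by
    refine ⟨Γ e' he', hΓ e' he', fun v hv' w => ?_⟩
    set e := chartAt E v.proj with he_def
    have he : e ∈ atlas E M := chart_mem_atlas E v.proj
    have hv : v.proj ∈ e.source := mem_chart_source E v.proj
    have hy : (tangentChart e v).1 ∈ (e.symm.trans e').source := by simp [tangentChart, hv, hv']
    have hφ : ContDiffAt ℝ 2 (e' ∘ e.symm) (tangentChart e v).1 :=
      (contDiffAt_transition he he' hy).of_le two_le_infty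
    have hs : IsSymmSndFDerivAt ℝ (e' ∘ e.symm) (tangentChart e v).1 :=
      hφ.isSymmSndFDerivAt (by simp)
    rw [mfderiv_tangentChart_eq he he' hv hv', (hasFDerivAt_tangentTransition hφ).fderiv,
      mfderiv_chart_eq he he' hv hv']
    have h1 : (tangentChart e' v).1 = (e' ∘ e.symm) (tangentChart e v).1 := by
      simp [tangentChart, e.left_inv hv]
    have h2 : (tangentChart e' v).2 =
        fderiv ℝ (e' ∘ e.symm) (tangentChart e v).1 (tangentChart e v).2 :=
      mfderiv_chart_eq he he' hv hv' v.2
    rw [h1, h2]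
    set dw : E × E := mfderiv 𝓘(ℝ, E).tangent 𝓘(ℝ, E × E) (tangentChart e) v w with hdw
    have h3 := hT e he e' he' _ hy (tangentChart e v).2 dw.1
    have h4 : ∀ z : E, (mfderiv 𝓘(ℝ, E) 𝓘(ℝ, E) e v.proj
        (((mdifferentiable_of_mem_atlas (I := 𝓘(ℝ, E)) he).mfderiv hv).symm z) : E) = z :=
      fun z => ((mdifferentiable_of_mem_atlas (I := 𝓘(ℝ, E)) he).mfderiv hv).apply_symm_apply z
    refine (congrArg (fderiv ℝ (e' ∘ e.symm) (e v.proj)) (h4 (dw.2 +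
      Γ e he (tangentChart e v).1 (tangentChart e v).2 dw.1))).trans ?_
    rw [map_add]
    refine (congrArg _ h3).trans ?_
    -- The transition map of `TM` produces `φ''(dw.1)(ξ)`, the law for `Γ` produces `φ''(ξ)(dw.1)`.
    have h5 := hs dw.1 (tangentChart e v).2
    simp only [ContinuousLinearMap.prod_apply, add_apply,
      ContinuousLinearMap.comp_apply, ContinuousLinearMap.coe_fst', ContinuousLinearMap.coe_snd',
      ContinuousLinearMap.flip_apply, h5]
    exact (add_assoc _ _ _).symm

end LinearConnections

/-! ### The connection of a vector bundle structure on `T^k M` -/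

section OscChristoffel

variable {E M : Type*} [NormedAddCommGroup E] [NormedSpace ℝ E] [TopologicalSpace M]
  [ChartedSpace E M] [IsManifold 𝓘(ℝ, E) ∞ M] {k : ℕ}

theorem contMDiffOn_oscChart {e : OpenPartialHomeomorph M E} (he : e ∈ atlas E M) :
    ContMDiffOn 𝓘(ℝ, E × (Fin k → E)) 𝓘(ℝ, E × (Fin k → E)) ∞ (oscChart k e he)
      (oscChart k e he).source := by
  have h : (oscCore E M k).openPartialHomeomorph (oscChart k e he) ⟨e, he, rfl⟩ ∈
      atlas (E × (Fin k → E)) (OscBundle E M k) := by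
    change _ ∈ ⋃ (c) (_ : c ∈ (oscCore E M k).atlas), _
    simp only [mem_iUnion]
    exact ⟨_, ⟨e, he, rfl⟩, rfl⟩
  exact contMDiffOn_of_mem_maximalAtlas
    (I := 𝓘(ℝ, E × (Fin k → E))) (n := ∞) (IsManifold.subset_maximalAtlas h)

theorem contMDiffOn_oscChart_symm {e : OpenPartialHomeomorph M E} (he : e ∈ atlas E M) :
    ContMDiffOn 𝓘(ℝ, E × (Fin k → E)) 𝓘(ℝ, E × (Fin k → E)) ∞ (oscChart k e he).symm
      (oscChart k e he).target := by
  have h : (oscCore E M k).openPartialHomeomorph (oscChart k e he) ⟨e, he, rfl⟩ ∈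
      atlas (E × (Fin k → E)) (OscBundle E M k) := by
    change _ ∈ ⋃ (c) (_ : c ∈ (oscCore E M k).atlas), _
    simp only [mem_iUnion]
    exact ⟨_, ⟨e, he, rfl⟩, rfl⟩
  exact contMDiffOn_symm_of_mem_maximalAtlas
    (I := 𝓘(ℝ, E × (Fin k → E))) (n := ∞) (IsManifold.subset_maximalAtlas h)

/-- The coordinate change of `T^k M` in the fibre over a point. -/
theorem oscChart_symm_jetMap {e e' : OpenPartialHomeomorph M E} (he : e ∈ atlas E M)
    (he' : e' ∈ atlas E M) {y : E} (hy : y ∈ (e.symm.trans e').source) (ξ : Fin k → E) :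
    (oscChart k e' he').symm ((e' ∘ e.symm) y, jetMap k (e' ∘ e.symm) y ξ) =
      (oscChart k e he).symm (y, ξ) := by
  have h := oscChart_transition k he he' (q := (y, ξ)) hy
  change oscChart k e' he' ((oscChart k e he).symm (y, ξ)) = _ at h
  change (oscChart k e' he').symm (_, fun i : Fin k => ((Nat.factorial (i + 1) : ℝ)⁻¹) •
    iteratedDeriv (i + 1) ((e' ∘ e.symm) ∘ polyCurve y ξ) 0) = _
  rw [← h]
  refine (oscChart k e' he').left_inv ?_
  change e.symm y ∈ e'.source
  simp at hy
  exact hy.2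

/-- This is the restriction to the fibre over `y` of a chart transition of `T^k M`, which is known
to be smooth. -/
theorem contDiffAt_jetMap {e e' : OpenPartialHomeomorph M E} (he : e ∈ atlas E M)
    (he' : e' ∈ atlas E M) {y : E} (hy : y ∈ (e.symm.trans e').source) (ξ : Fin k → E) :
    ContDiffAt ℝ ∞ (jetMap k (e' ∘ e.symm) y) ξ := by
  have h := contDiffOn_oscChart_transition k he he'
  rw [oscChart_trans_source] at h
  have h1 := h.contDiffAt (x := (y, ξ))
    (((e.symm.trans e').open_source.prod isOpen_univ).mem_nhds ⟨hy, mem_univ _⟩)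
  have h2 := contDiffAt_snd.comp ξ (h1.comp ξ (contDiffAt_const.prodMk contDiffAt_id))
  refine h2.congr_of_eventuallyEq (Eventually.of_forall fun ξ => ?_)
  exact (congrArg Prod.snd (oscChart_transition k he he' (q := (y, ξ)) hy)).symm

variable (E M k) in
/-- The total space of the family of fibres `T_x^k M`. -/
abbrev OscTotalSpace : Type _ := TotalSpace (Fin k → E) (OscFiber E k : M → Type _)

variable [OscVectorBundle E M k]

/-- The fibre coordinate change from a chart of `T^k M` to a local trivialization of a vector
bundle structure. -/
def oscFibreCoord {e : OpenPartialHomeomorph M E} (he : e ∈ atlas E M)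
    (t : Trivialization (Fin k → E) (TotalSpace.proj : OscTotalSpace E M k → M)) (y : E) (ξ : Fin k → E) :
    Fin k → E :=
  (t ⟨((oscChart k e he).symm (y, ξ)).proj, ((oscChart k e he).symm (y, ξ)).jet⟩).2

variable {e e' : OpenPartialHomeomorph M E} (he : e ∈ atlas E M) (he' : e' ∈ atlas E M)
  (t t' : Trivialization (Fin k → E) (TotalSpace.proj : OscTotalSpace E M k → M))
  [MemTrivializationAtlas t] [MemTrivializationAtlas t']

theorem contDiffAt_oscFibreCoord {y : E} (hy : y ∈ e.target) (hyt : e.symm y ∈ t.baseSet)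
    (ξ : Fin k → E) :
    ContDiffAt ℝ ∞ (fun q : E × (Fin k → E) => oscFibreCoord he t q.1 q.2) (y, ξ) := by
  have hU : (y, ξ) ∈ (oscChart k e he).target := ⟨hy, mem_univ _⟩
  have h1 : ContMDiffAt 𝓘(ℝ, E × (Fin k → E)) 𝓘(ℝ, E × (Fin k → E)) ∞ (oscChart k e he).symm
      (y, ξ) := (contMDiffOn_oscChart_symm he).contMDiffAt
    ((e.open_target.prod isOpen_univ).mem_nhds hU)
  have h2 := (OscVectorBundle.contMDiff_toTotalSpace (E := E) (M := M) (k := k)).contMDiffAt.comp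
    (y, ξ) h1
  have hs : (⟨((oscChart k e he).symm (y, ξ)).proj, ((oscChart k e he).symm (y, ξ)).jet⟩ :
      OscTotalSpace E M k) ∈ t.source := t.mem_source.2 hyt
  have h3 := (t.contMDiffAt_iff (f := fun q : E × (Fin k → E) =>
    (⟨((oscChart k e he).symm q).proj, ((oscChart k e he).symm q).jet⟩ : OscTotalSpace E M k))
    (x₀ := (y, ξ)) hs).1 h2
  exact h3.2.contDiffAt

/-- The identification of `T^k M` with the total space is smooth in both directions, so the fibre
coordinate change has a differentiable two-sided inverse `Ψ`. The chain rule then inverts its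
derivative. -/
theorem isInvertible_fderiv_oscFibreCoord {y : E} (hy : y ∈ e.target)
    (hyt : e.symm y ∈ t.baseSet) (ξ : Fin k → E) :
    (fderiv ℝ (oscFibreCoord he t y) ξ).IsInvertible := by
  let g : (Fin k → E) → OscBundle E M k := fun η =>
    ⟨(t.toOpenPartialHomeomorph.symm (e.symm y, η)).proj,
      (t.toOpenPartialHomeomorph.symm (e.symm y, η)).snd⟩
  have hproj : ∀ η, (g η).proj = e.symm y := fun η => t.proj_symm_apply' hyt
  have hgs : ∀ η, g η ∈ (oscChart k e he).source := by
    intro η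
    change (g η).proj ∈ e.source
    rw [hproj]
    exact e.map_target hy
  let Ψ : (Fin k → E) → (Fin k → E) := fun η => (oscChart k e he (g η)).2
  have hgf : ∀ ξ, g (oscFibreCoord he t y ξ) = (oscChart k e he).symm (y, ξ) := by
    intro ξ
    have hs : (⟨((oscChart k e he).symm (y, ξ)).proj, ((oscChart k e he).symm (y, ξ)).jet⟩ :
      OscTotalSpace E M k) ∈ t.source := t.mem_source.2 hyt
    have h := t.toOpenPartialHomeomorph.left_inv hs
    have h2 := t.mk_proj_snd hs
    have h3 : t.toOpenPartialHomeomorph.symm (e.symm y, oscFibreCoord he t y ξ) =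
        ⟨((oscChart k e he).symm (y, ξ)).proj, ((oscChart k e he).symm (y, ξ)).jet⟩ := by
      rw [← h]
      congr 1
    change OscBundle.mk _ _ = _
    rw [h3]
  have hΨf : Ψ ∘ oscFibreCoord he t y = id := by
    funext ξ
    change (oscChart k e he (g (oscFibreCoord he t y ξ))).2 = ξ
    rw [hgf, (oscChart k e he).right_inv ⟨hy, mem_univ _⟩]
  have hfΨ : oscFibreCoord he t y ∘ Ψ = id := by
    funext η
    have h1 : (y, Ψ η) = oscChart k e he (g η) := by
      refine Prod.ext ?_ rfl
      change y = e (g η).proj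
      rw [hproj, e.right_inv hy]
    change (t ⟨((oscChart k e he).symm (y, Ψ η)).proj, _⟩).2 = η
    rw [h1, (oscChart k e he).left_inv (hgs η)]
    change (t (t.toOpenPartialHomeomorph.symm (e.symm y, η))).2 = η
    rw [t.apply_symm_apply' hyt]
  have hΨ : ∀ η, DifferentiableAt ℝ Ψ η := by
    intro η
    have h1 : ContMDiffAt 𝓘(ℝ, Fin k → E) (𝓘(ℝ, E).prod 𝓘(ℝ, Fin k → E)) ∞
        (fun η => t.toOpenPartialHomeomorph.symm (e.symm y, η)) η :=
      (t.contMDiffOn_symm.contMDiffAt (x := (e.symm y, η))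
        (t.open_target.mem_nhds (t.mem_target.2 hyt))).comp η
          (contMDiffAt_const.prodMk contMDiffAt_id)
    have h2 : ContMDiffAt 𝓘(ℝ, Fin k → E) 𝓘(ℝ, E × (Fin k → E)) ∞ g η :=
      (OscVectorBundle.contMDiff_ofTotalSpace (E := E) (M := M) (k := k)).contMDiffAt.comp η h1
    have hopen : IsOpen (oscChart k e he).source :=
      (oscCore E M k).open_source' ⟨e, he, rfl⟩
    have h3 := ((contMDiffOn_oscChart he).contMDiffAt (hopen.mem_nhds (hgs η))).comp η h2
    exact (contDiffAt_snd.comp η h3.contDiffAt).differentiableAt (by simp)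
  have hf : ∀ ξ, DifferentiableAt ℝ (oscFibreCoord he t y) ξ := fun ξ =>
    (((contDiffAt_oscFibreCoord he t hy hyt ξ).comp ξ
      (contDiffAt_const.prodMk contDiffAt_id)).differentiableAt (by simp))
  have hΨf' : Ψ (oscFibreCoord he t y ξ) = ξ := congrFun hΨf ξ
  refine ContinuousLinearMap.IsInvertible.of_inverse
    (g := fderiv ℝ Ψ (oscFibreCoord he t y ξ)) ?_ ?_
  · have h := fderiv_comp (oscFibreCoord he t y ξ) (hf _) (hΨ (oscFibreCoord he t y ξ))
    rw [hfΨ, fderiv_id, hΨf'] at h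
    exact h.symm
  · have h := fderiv_comp ξ (hΨ (oscFibreCoord he t y ξ)) (hf ξ)
    rw [hΨf, fderiv_id] at h
    exact h.symm

/-- Both sides are the `t'` coordinates of one jet, reached through the chart `e'` or through `t`.
The linear structure of the fibres enters through the linearity of the map between the
trivializations. -/
theorem oscFibreCoord_transition {y : E} (hy : y ∈ (e.symm.trans e').source)
    (hyt : e.symm y ∈ t.baseSet) (hyt' : e.symm y ∈ t'.baseSet) :
    oscFibreCoord he' t' ((e' ∘ e.symm) y) ∘ jetMap k (e' ∘ e.symm) y =
      t.coordChangeL ℝ t' (e.symm y) ∘ oscFibreCoord he t y := by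
  funext ξ
  change (t' ⟨((oscChart k e' he').symm (_, jetMap k _ y ξ)).proj, _⟩).2 = _
  rw [oscChart_symm_jetMap he he' hy]
  have hs : (⟨((oscChart k e he).symm (y, ξ)).proj, ((oscChart k e he).symm (y, ξ)).jet⟩ :
      OscTotalSpace E M k) ∈ t.source := t.mem_source.2 hyt
  have h2 := t.mk_proj_snd hs
  change _ = t.coordChangeL ℝ t' (e.symm y) (oscFibreCoord he t y ξ)
  rw [t.coordChangeL_apply' t' ⟨hyt, hyt'⟩]
  have h3 : t.toOpenPartialHomeomorph.symm (e.symm y, oscFibreCoord he t y ξ) =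
      ⟨((oscChart k e he).symm (y, ξ)).proj, ((oscChart k e he).symm (y, ξ)).jet⟩ := by
    have h := t.toOpenPartialHomeomorph.left_inv hs
    rw [← h]
    congr 1
  rw [h3]

/-- The local component, in a chart of `M` and a local trivialization, of the linear connection
defined by a vector bundle structure on `T^k M`. -/
def oscChristoffel (hk : 1 < k) (y : E) : E →L[ℝ] E →L[ℝ] E :=
  fibreChristoffel (ContinuousLinearMap.single ℝ (fun _ : Fin k => E) ⟨0, by omega⟩)
    (ContinuousLinearMap.proj (R := ℝ) (φ := fun _ : Fin k => E) ⟨1, hk⟩) (oscFibreCoord he t y)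

theorem oscChristoffel_transition (hk : 1 < k) {y : E} (hy : y ∈ (e.symm.trans e').source)
    (hyt : e.symm y ∈ t.baseSet) (hyt' : e.symm y ∈ t'.baseSet) (u v : E) :
    fderiv ℝ (e' ∘ e.symm) y (oscChristoffel he t hk y u v) =
      fderiv ℝ (fderiv ℝ (e' ∘ e.symm)) y u v +
        oscChristoffel he' t' hk ((e' ∘ e.symm) y) (fderiv ℝ (e' ∘ e.symm) y u)
          (fderiv ℝ (e' ∘ e.symm) y v) := by
  have hφ : ContDiffAt ℝ 2 (e' ∘ e.symm) y :=
    (contDiffAt_transition he he' hy).of_le two_le_infty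
  have hT := (contDiffAt_jetMap (k := k) he he' hy 0).of_le two_le_infty
  have hTd : DifferentiableAt ℝ (jetMap k (e' ∘ e.symm) y) 0 := hT.differentiableAt (by simp)
  have hy1 : y ∈ e.target := by simp at hy; exact hy.1
  have hy2 : e.symm y ∈ e'.source := by simp at hy; exact hy.2
  have hy1' : (e' ∘ e.symm) y ∈ e'.target := e'.map_source hy2
  have hyt1 : e'.symm ((e' ∘ e.symm) y) ∈ t'.baseSet := by
    rwa [Function.comp_apply, e'.left_inv hy2]
  have hc : ∀ {e : OpenPartialHomeomorph M E} (he : e ∈ atlas E M)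
      (t : Trivialization (Fin k → E) (TotalSpace.proj : OscTotalSpace E M k → M))
      [MemTrivializationAtlas t] {y : E}, y ∈ e.target → e.symm y ∈ t.baseSet →
      ContDiffAt ℝ 2 (oscFibreCoord he t y) 0 := fun he t _ y hy hyt =>
    ((contDiffAt_oscFibreCoord he t hy hyt 0).comp 0
      (contDiffAt_const.prodMk contDiffAt_id)).of_le two_le_infty
  have key := fibreChristoffel_transform
    (ι := ContinuousLinearMap.single ℝ (fun _ : Fin k => E) ⟨0, by omega⟩)
    (P := ContinuousLinearMap.proj (R := ℝ) (φ := fun _ : Fin k => E) ⟨1, hk⟩)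
    (L := fderiv ℝ (e' ∘ e.symm) y) (hc he t hy1 hyt) (hc he' t' hy1' hyt1) hT (jetMap_zero _ _)
    (oscFibreCoord_transition he he' t t' hy hyt hyt')
    (isInvertible_fderiv_oscFibreCoord he t hy1 hyt 0)
    (isInvertible_fderiv_oscFibreCoord he' t' hy1' hyt1 0)
    (fun u => fderiv_jetMap_single (by omega) (hφ.differentiableAt (by simp)) hTd u)
    -- At `ξ = 0` the quadratic term of the second component has derivative zero, which leaves
    -- `φ'(y)` applied to `ξ₂`.
    (fun ξ => by
      have h1 := (hasFDerivAt_jetMap_second hk hφ 0).fderiv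
      rw [fderiv_comp 0 (ContinuousLinearMap.differentiableAt _) hTd,
        ContinuousLinearMap.fderiv] at h1
      simpa using congrArg (fun A => A ξ) h1) u v
  rw [fderiv_fderiv_jetMap_second hk hφ] at key
  simp only [ContinuousLinearMap.single_apply, Pi.single_eq_same] at key
  exact key

/-- The transformation law with `e' = e`: the chart change is the identity near `y`, so its first
derivative is the identity and its second derivative vanishes. -/
theorem oscChristoffel_congr (hk : 1 < k) {y : E} (hy : y ∈ e.target)
    (hyt : e.symm y ∈ t.baseSet) (hyt' : e.symm y ∈ t'.baseSet) :
    oscChristoffel he t hk y = oscChristoffel he t' hk y := by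
  have hs : y ∈ (e.symm.trans e).source := by simp [hy]
  have hev : e ∘ e.symm =ᶠ[𝓝 y] id := by
    filter_upwards [e.open_target.mem_nhds hy] with z hz
    exact e.right_inv hz
  have h1 : fderiv ℝ (e ∘ e.symm) y = ContinuousLinearMap.id ℝ E := by
    rw [hev.fderiv_eq, fderiv_id]
  have h2 : fderiv ℝ (fderiv ℝ (e ∘ e.symm)) y = 0 := by
    have : fderiv ℝ (e ∘ e.symm) =ᶠ[𝓝 y] fun _ => ContinuousLinearMap.id ℝ E := by
      filter_upwards [hev.fderiv (𝕜 := ℝ)] with z hz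
      rw [hz, fderiv_id]
    rw [this.fderiv_eq]
    simp
  ext u v
  have h := oscChristoffel_transition he he t t' hk hs hyt hyt' u v
  rw [h1, h2] at h
  simpa [e.right_inv hy] using h

theorem contDiffAt_oscChristoffel [CompleteSpace E] (hk : 1 < k) {y : E} (hy : y ∈ e.target)
    (hyt : e.symm y ∈ t.baseSet) : ContDiffAt ℝ ∞ (oscChristoffel he t hk) y :=
  contDiffAt_fibreChristoffel _ _ (contDiffAt_oscFibreCoord he t hy hyt 0)
    (isInvertible_fderiv_oscFibreCoord he t hy hyt 0)

variable (E M) in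
/-- The linear connection defined by a smooth vector bundle structure on `T^k M`, `1 < k`. -/
def LinearConnection.ofOscVectorBundle [CompleteSpace E] (hk : 1 < k) : LinearConnection E M :=
  LinearConnection.ofChristoffel
    (fun e he y => oscChristoffel (k := k) he
      (trivializationAt (Fin k → E) (OscFiber E k : M → Type _) (e.symm y)) hk y)
    (fun e he y hy => by
      refine ContDiffAt.contDiffWithinAt ?_
      have hm := mem_baseSet_trivializationAt (Fin k → E) (OscFiber E k : M → Type _) (e.symm y)
      -- The trivialization in the definition varies with the point. Near `y` it may be frozen to
      -- the one at `e.symm y`, since `Γ` is independent of that choice.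
      refine (contDiffAt_oscChristoffel he
        (trivializationAt (Fin k → E) (OscFiber E k : M → Type _) (e.symm y)) hk hy
        hm).congr_of_eventuallyEq ?_
      filter_upwards [e.open_target.mem_nhds hy, (e.continuousAt_symm hy).preimage_mem_nhds
        ((trivializationAt (Fin k → E) (OscFiber E k : M → Type _)
          (e.symm y)).open_baseSet.mem_nhds hm)] with z hz hzt
      exact oscChristoffel_congr he _ _ hk hz (mem_baseSet_trivializationAt _ _ _) hzt)
    (fun e he e' he' y hy u v => oscChristoffel_transition he he' _ _ hk hy
      (mem_baseSet_trivializationAt _ _ _) (by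
        have hy2 : e.symm y ∈ e'.source := by simp at hy; exact hy.2
        rw [Function.comp_apply, e'.left_inv hy2]
        exact mem_baseSet_trivializationAt _ _ _) u v)

end OscChristoffel

end

/-- The vector bundle structure alone determines a smooth linear connection: its fibre coordinates
have, at the constant jets, first and second derivatives which combine to Christoffel symbols.
So neither the partitions of unity nor the isomorphism with the Whitney sum is needed. -/
theorem theorem3p6 {E M : Type*} [NormedAddCommGroup E] [NormedSpace ℝ E] [CompleteSpace E]
    [TopologicalSpace M] [ChartedSpace E M] [IsManifold 𝓘(ℝ, E) ∞ M]
    (k : ℕ) (hk : 2 ≤ k) (hM : IsPartitionable E M k)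
    (h : ∃ _ : OscVectorBundle E M k, Nonempty (SmoothVectorBundleIso
      (E := E)
      (Fin k → E) (OscFiber E k : M → Type _) (Fin k → E) (TangentPower E k : M → Type _))) :
    Nonempty (LinearConnection E M) := by
  obtain ⟨_, -⟩ := h
  exact ⟨LinearConnection.ofOscVectorBundle E M (k := k) hk⟩
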